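/- \textbf{Corollary (blow-up of negative self-similar solutions).} Let $k_n=2^n$ and consider the unforced inviscid dyadic model \[ X_0(t)=0,\qquad \dot X_n(t)=k_{n-1}X_{n-1}^2(t)-k_nX_n(t)X_{n+1}(t),\quad n\ge 1 . \] A (componentwise) solution on an interval $I$ is a sequence $X=(X_n)$ of continuously differentiable real functions on $I$ that satisfies all these equations on $I$; it has finite energy if $\sum_{n\ge1}X_n(t)^2<\infty$ for every $t\in I$, it is positive (negative) if $X_n(t)\ge0$ (respectively $X_n(t)\le0$) for all $n\ge1$ and $t\in I$, and it is self-similar if there are real numbers $a_n$ and a function $\varphi$ with $X_n(t)=a_n\varphi(t)$ for all $n\ge1$, $t\in I$. For every $t_0>0$ and every integer $n_0\ge0$ there is a unique negative finite-energy self-similar solution $Y$ on $[0,t_0)$ of the form \[ Y_n(t)=\frac{a_n}{t-t_0},\qquad n\ge1,\ t\in[0,t_0),\qquad\text{with } a_1=\dots=a_{n_0}=0,\quad a_{n_0+1}\neq0 , \] and its coefficients $a_n$, $n\ge1$, are unique. $Y$ is also the unique negative finite-energy self-similar solution on $[0,t_0)$ of the general form $a_n\varphi(t)$, with $a_1=\dots=a_{n_0}=0$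 and $a_{n_0+1}\ne0$, that is maximal, i.e. that is not the restriction of a solution of the same kind on $[0,T)$ for some $T>t_0$. For every $n>n_0$ one has $a_n>0$, $Y_n<0$ on $[0,t_0)$ and $\lim_{t\to t_0^-}Y_n(t)=-\infty$; thus every component that does not vanish identically blows up at time $t_0$. Finally, there is a positive finite-energy self-similar solution of the form $X_n(t)=b_n/(t+t_0)$ on $(-t_0,\infty)$ with $b_1=\dots=b_{n_0}=0$ and $b_{n_0+1}\neq0$, one such solution has $b_n=a_n$ for all $n\ge1$, and every such solution satisfies $Y(t)=-X(-t)$ for $t\in[0,t_0)$. -/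

import Mathlib

open Set Filter Topology

/-- The coefficients `k_n = 2^n` of the dyadic model. -/
noncomputable def dyadicK (n : ℕ) : ℝ := 2 ^ n

/-- Componentwise solutions, on a time interval `I`, of the unforced inviscid dyadic model
`X_0 = 0`, `X_n' = k_{n-1} X_{n-1}^2 - k_n X_n X_{n+1}` for `n ≥ 1` (the equations below are
indexed by `n + 1`). At an end point that belongs to `I` the derivative is one-sided. -/
structure IsDyadicSolutionOn (I : Set ℝ) (X : ℕ → ℝ → ℝ) : Prop where
  zero : ∀ t ∈ I, X 0 t = 0
  contDiffOn : ∀ n, ContDiffOn ℝ 1 (X n) I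
  equation : ∀ n, ∀ t ∈ I,
    HasDerivWithinAt (X (n + 1))
      (dyadicK n * X n t ^ 2 - dyadicK (n + 1) * X (n + 1) t * X (n + 2) t) I t

/-- Finite energy on `I`: the sequence `(X_n(t))_{n ≥ 1}` is square summable for all `t ∈ I`. -/
def HasFiniteEnergyOn (I : Set ℝ) (X : ℕ → ℝ → ℝ) : Prop :=
  ∀ t ∈ I, Summable fun n : ℕ => X (n + 1) t ^ 2

/-- All components are non-negative on `I`. -/
def IsPositiveOn (I : Set ℝ) (X : ℕ → ℝ → ℝ) : Prop :=
  ∀ n, 1 ≤ n → ∀ t ∈ I, 0 ≤ X n t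

/-- All components are non-positive on `I`. -/
def IsNegativeOn (I : Set ℝ) (X : ℕ → ℝ → ℝ) : Prop :=
  ∀ n, 1 ≤ n → ∀ t ∈ I, X n t ≤ 0

/-- `a_1 = ⋯ = a_{n₀} = 0` and `a_{n₀+1} ≠ 0`. -/
def HasLeadingIndex (n₀ : ℕ) (a : ℕ → ℝ) : Prop :=
  (∀ n, 1 ≤ n → n ≤ n₀ → a n = 0) ∧ a (n₀ + 1) ≠ 0

/-- `X` is a finite energy self-similar solution on `I`, i.e. one of the form
`X_n(t) = a_n φ(t)`, with `a_1 = ⋯ = a_{n₀} = 0` and `a_{n₀+1} ≠ 0`. -/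
def IsSelfSimilarSolutionOn (I : Set ℝ) (n₀ : ℕ) (X : ℕ → ℝ → ℝ) : Prop :=
  IsDyadicSolutionOn I X ∧ HasFiniteEnergyOn I X ∧
    ∃ (a : ℕ → ℝ) (φ : ℝ → ℝ), HasLeadingIndex n₀ a ∧
      ∀ n, 1 ≤ n → ∀ t ∈ I, X n t = a n * φ t

/-- `X` is a finite energy self-similar solution on `I` of the form `X_n(t) = a_n / (t - τ)`,
with `a_1 = ⋯ = a_{n₀} = 0` and `a_{n₀+1} ≠ 0`. -/
def IsSelfSimilarSolutionWith (I : Set ℝ) (τ : ℝ) (n₀ : ℕ) (a : ℕ → ℝ) (X : ℕ → ℝ → ℝ) :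
    Prop :=
  IsDyadicSolutionOn I X ∧ HasFiniteEnergyOn I X ∧ HasLeadingIndex n₀ a ∧
    ∀ n, 1 ≤ n → ∀ t ∈ I, X n t = a n / (t - τ)

/-- `X` on `[0, T)` is a negative finite energy self-similar solution (of the general form
`a_n φ(t)`), with leading index `n₀ + 1`, that is not the restriction to `[0, T)` of such a
solution on a longer interval `[0, T')`. -/
def IsMaximalNegativeSelfSimilar (T : ℝ) (n₀ : ℕ) (X : ℕ → ℝ → ℝ) : Prop :=
  IsSelfSimilarSolutionOn (Ico 0 T) n₀ X ∧ IsNegativeOn (Ico 0 T) X ∧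
    ¬ ∃ T' : ℝ, T < T' ∧ ∃ X' : ℕ → ℝ → ℝ,
      IsSelfSimilarSolutionOn (Ico 0 T') n₀ X' ∧ IsNegativeOn (Ico 0 T') X' ∧
        ∀ n, ∀ t ∈ Ico (0 : ℝ) T, X' n t = X n t

/-! For `X_n = a_n / (t - τ)` the model reduces to a recurrence on the coefficients, so the theorem
concerns profiles. Leading zeros can be stripped by rescaling, which leaves one parameter, the first
entry `x > 0`.

Existence (`exists_isDyadicProfile_summable`) is a shooting argument. For large `n` the ratio `ρ` of
consecutive entries is nearly mapped to `1 / (2ρ²)`, whose fixed point `2^(-1/3)` is repelling.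
Nested compact sets of parameters keep all ratios from index 3 on in `[0.7, 0.99]`; a common point
gives geometric decay.

Uniqueness (`IsDyadicProfile.eq_of_tendsto`) uses the same instability. If two profiles differ in
the first entry, the quotient of their odd entries grows at least like `6^k`, while energy flux and
decay allow only `4^k`.

For a general `a_n φ(t)`, the first nonzero component satisfies `ψ' = -μ ψ²`
(`IsMaximalNegativeSelfSimilar.exists_form`). This forces `φ` to be a multiple of `1 / (t - τ)`, and
maximality forces `τ` to be the end of the interval. -/

/-- Coefficient sequences of self-similar solutions: `c_0 = 0` and
`k_{n+1} c_{n+1} c_{n+2} = c_{n+1} + k_n c_n ^ 2`. -/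
structure IsDyadicProfile (c : ℕ → ℝ) : Prop where
  zero : c 0 = 0
  recurrence : ∀ n, dyadicK (n + 1) * c (n + 1) * c (n + 2) = c (n + 1) + dyadicK n * c n ^ 2

lemma dyadicK_pos (n : ℕ) : 0 < dyadicK n := by unfold dyadicK; positivity

lemma dyadicK_succ (n : ℕ) : dyadicK (n + 1) = 2 * dyadicK n := by
  unfold dyadicK; rw [pow_succ]; ring

lemma dyadicK_add (m n : ℕ) : dyadicK (m + n) = dyadicK m * dyadicK n := by
  unfold dyadicK; rw [pow_add]

/-! ### Uniqueness of positive profiles that tend to zero. -/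

namespace IsDyadicProfile

variable {c d : ℕ → ℝ}

lemma pos (hc : IsDyadicProfile c) (h1 : 0 < c 1) (n : ℕ) : 0 < c (n + 1) := by
  induction n with
  | zero => exact h1
  | succ n ih =>
    have h := hc.recurrence n
    have hk := dyadicK_pos n
    have h2 : 0 < dyadicK (n + 1) * c (n + 1) * c (n + 2) := by rw [h]; positivity
    exact (pos_iff_pos_of_mul_pos h2).1 (mul_pos (dyadicK_pos _) ih)

lemma succ_succ (hc : IsDyadicProfile c) (h1 : 0 < c 1) (n : ℕ) :
    c (n + 2) = 1 / dyadicK (n + 1) + c n ^ 2 / (2 * c (n + 1)) := by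
  have h := hc.recurrence n
  have hp := hc.pos h1 n
  have hk := dyadicK_pos n
  rw [dyadicK_succ] at h ⊢
  field_simp
  linarith

/-- The energy flux through shell `n` is at least the energy of the first shell. -/
lemma sq_le_flux (hc : IsDyadicProfile c) (n : ℕ) :
    c 1 ^ 2 ≤ dyadicK (n + 1) * c (n + 1) ^ 2 * c (n + 2) := by
  induction n with
  | zero =>
    have h := hc.recurrence 0
    rw [hc.zero] at h
    simp only [zero_add] at h ⊢
    linear_combination -c 1 * h
  | succ n ih =>
    have h := hc.recurrence (n + 1)
    simp only [add_assoc, Nat.reduceAdd] at h ⊢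
    linear_combination ih + sq_nonneg (c (n + 2)) - c (n + 2) * h

/-- The flux stays at least `c 1 ^ 2` while `c (n + 1) ^ 2` drops below a quarter of that. Hence the
term `1 / dyadicK (n + 1)` of the recurrence eventually makes up at most a quarter of `c (n + 2)`.
-/
lemma eventually_large (hc : IsDyadicProfile c) (h1 : 0 < c 1)
    (hs : Tendsto c atTop (𝓝 0)) :
    ∀ᶠ n in atTop, 4 ≤ dyadicK (n + 1) * c (n + 2) := by
  have h : ∀ᶠ n in atTop, c n < c 1 / 2 := hs.eventually_lt_const (by positivity)
  filter_upwards [(tendsto_add_atTop_nat 1).eventually h] with n hn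
  have hp := hc.pos h1 n
  have hf := hc.sq_le_flux n
  have hsq : 4 * c (n + 1) ^ 2 ≤ c 1 ^ 2 := by nlinarith
  have hpos : 0 < c (n + 1) ^ 2 := by positivity
  by_contra! hlt
  nlinarith [mul_lt_mul_of_pos_right hlt hpos]

/-- By `succ_succ`, an entry increases with the one two places back and decreases with the preceding
one. The second entry is always `1 / 2`, so the order propagates with alternating direction. -/
lemma alternating_le (hc : IsDyadicProfile c) (hd : IsDyadicProfile d) (hc1 : 0 < c 1)
    (hd1 : 0 < d 1) (h : c 1 ≤ d 1) (k : ℕ) :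
    c (2 * k + 1) ≤ d (2 * k + 1) ∧ d (2 * k + 2) ≤ c (2 * k + 2) := by
  induction k with
  | zero =>
    refine ⟨h, le_of_eq ?_⟩
    have h1 := hc.succ_succ hc1 0
    have h2 := hd.succ_succ hd1 0
    rw [hc.zero] at h1
    rw [hd.zero] at h2
    simp only [mul_zero, zero_add] at h1 h2 ⊢
    rw [h1, h2]; simp
  | succ k ih =>
    obtain ⟨ho, he⟩ := ih
    have p1 := hc.pos hc1 (2 * k)
    have p2 := hd.pos hd1 (2 * k + 1)
    have p3 := hc.pos hc1 (2 * k + 1 + 1)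
    have q2 : 0 < d (2 * k + 2) := p2
    have h3 : c (2 * k + 1 + 2) ≤ d (2 * k + 1 + 2) := by
      rw [hc.succ_succ hc1, hd.succ_succ hd1]
      gcongr
    refine ⟨h3, ?_⟩
    change d (2 * k + 2 + 2) ≤ c (2 * k + 2 + 2)
    rw [hc.succ_succ hc1, hd.succ_succ hd1]
    have q3 : 0 < c (2 * k + 2 + 1) := p3
    have h3' : c (2 * k + 2 + 1) ≤ d (2 * k + 2 + 1) := h3
    gcongr

end IsDyadicProfile

/-- The factor `3/4 * (r + 2)` is at least `3/2`, so `r` reaches 6; from there it is at least `6`,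
and `6^j` beats `4^j`. -/
lemma not_bounded_of_quadratic_growth {r : ℕ → ℝ} (h0 : 0 < r 0)
    (hr : ∀ k, 3 / 4 * (r k * (r k + 2)) ≤ r (k + 1)) (C : ℝ) (hC : ∀ k, r k ≤ C * 4 ^ k) :
    False := by
  have h1 : ∀ k, r 0 * (3 / 2) ^ k ≤ r k := by
    intro k
    induction k with
    | zero => simp
    | succ k ih =>
      have : 0 < r 0 * (3 / 2) ^ k := by positivity
      rw [pow_succ]
      nlinarith [hr k, sq_nonneg (r k)]
  have ht : Tendsto (fun k : ℕ => r 0 * (3 / 2 : ℝ) ^ k) atTop atTop :=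
    (tendsto_pow_atTop_atTop_of_one_lt (by norm_num)).const_mul_atTop h0
  obtain ⟨K, hK⟩ := (ht.eventually_ge_atTop 6).exists
  have h2 : ∀ j, 6 * 6 ^ j ≤ r (K + j) := by
    intro j
    induction j with
    | zero => simpa using hK.trans (h1 K)
    | succ j ih =>
      have h6 : (1 : ℝ) ≤ 6 ^ j := one_le_pow₀ (by norm_num)
      have := hr (K + j)
      rw [pow_succ, ← add_assoc]
      nlinarith
  have ht2 : Tendsto (fun j : ℕ => (3 / 2 : ℝ) ^ j) atTop atTop :=
    tendsto_pow_atTop_atTop_of_one_lt (by norm_num)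
  obtain ⟨j, hj⟩ := (ht2.eventually_gt_atTop (C * 4 ^ K)).exists
  have h3 := (h2 j).trans (hC (K + j))
  have h4 : (6 : ℝ) ^ j = (3 / 2) ^ j * 4 ^ j := by rw [← mul_pow]; norm_num
  rw [h4, pow_add] at h3
  have h5 : (0 : ℝ) < 4 ^ j := by positivity
  have h6 : (0 : ℝ) < (3 / 2) ^ j := by positivity
  nlinarith [mul_lt_mul_of_pos_right hj h5, mul_pos h5 h6]

namespace IsDyadicProfile

variable {c d : ℕ → ℝ}

lemma not_lt_of_tendsto (hc : IsDyadicProfile c) (hd : IsDyadicProfile d) (hc1 : 0 < c 1)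
    (hd1 : 0 < d 1) (hcs : Tendsto c atTop (𝓝 0)) (hds : Tendsto d atTop (𝓝 0)) :
    ¬ c 1 < d 1 := by
  intro hlt
  have hodd : ∀ k, c (2 * k + 1) < d (2 * k + 1) := by
    intro k
    induction k with
    | zero => exact hlt
    | succ k ih =>
      change c (2 * k + 1 + 2) < d (2 * k + 1 + 2)
      rw [hc.succ_succ hc1, hd.succ_succ hd1]
      have he := (hc.alternating_le hd hc1 hd1 hlt.le k).2
      have p1 := hc.pos hc1 (2 * k)
      have p2 : 0 < d (2 * k + 1 + 1) := hd.pos hd1 (2 * k + 1)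
      have p3 : 0 < c (2 * k + 1 + 1) := hc.pos hc1 (2 * k + 1)
      have he' : d (2 * k + 1 + 1) ≤ c (2 * k + 1 + 1) := he
      have : c (2 * k + 1) ^ 2 / (2 * c (2 * k + 1 + 1))
          < d (2 * k + 1) ^ 2 / (2 * d (2 * k + 1 + 1)) := by
        apply div_lt_div₀ <;> first | positivity | gcongr
      linarith
  obtain ⟨N, hN⟩ := eventually_atTop.1
    ((hc.eventually_large hc1 hcs).and (hds.eventually_le_const (zero_lt_one)))
  -- The extra `+ 1` makes each denominator an entry `c (n + 2)` with `n ≥ N`, so that its lower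
  -- bound `4 / dyadicK (n + 1)` is available from `k = 0` on.
  set r : ℕ → ℝ := fun k => d (2 * (k + N + 1) + 1) / c (2 * (k + N + 1) + 1) - 1 with hr
  refine not_bounded_of_quadratic_growth (r := r) ?_ ?_ (4 ^ (N + 1)) ?_
  · have := hc.pos hc1 (2 * (0 + N + 1))
    simp only [hr, sub_pos]
    rw [one_lt_div this]
    exact hodd _
  · intro k
    simp only [hr]
    set n := 2 * (k + N + 1) + 1 with hn
    have e : 2 * (k + 1 + N + 1) + 1 = n + 2 := by omega
    rw [e]
    have p1 : 0 < c n := hc.pos hc1 _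
    have p2 : 0 < c (n + 1) := hc.pos hc1 _
    have p3 : 0 < c (n + 2) := hc.pos hc1 _
    have q2 : 0 < d (n + 1) := hd.pos hd1 _
    have he : d (n + 1) ≤ c (n + 1) := (hc.alternating_le hd hc1 hd1 hlt.le _).2
    have hlarge := (hN n (by omega)).1
    have hk := dyadicK_pos (n + 1)
    have hcn := hc.succ_succ hc1 n
    have hdn := hd.succ_succ hd1 n
    have hdn' : 1 / dyadicK (n + 1) + d n ^ 2 / (2 * c (n + 1)) ≤ d (n + 2) := by
      rw [hdn]; gcongr
    have hinv : 1 / dyadicK (n + 1) ≤ c (n + 2) / 4 := by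
      rw [div_le_div_iff₀ hk (by norm_num)]; linarith
    have hw : 3 / 4 * c (n + 2) ≤ c n ^ 2 / (2 * c (n + 1)) := by linarith
    set R := d n / c n with hR
    have hR1 : 1 < R := by rw [hR, one_lt_div p1]; exact hodd _
    have hdR : d n = R * c n := by rw [hR]; field_simp
    have hsplit : d n ^ 2 / (2 * c (n + 1)) = R ^ 2 * (c n ^ 2 / (2 * c (n + 1))) := by
      rw [hdR]; ring
    rw [le_sub_iff_add_le, le_div_iff₀ p3]
    rw [hsplit] at hdn'
    -- With `w = c n ^ 2 / (2 * c (n + 1))`, `d (n + 2)` exceeds `c (n + 2)` by at least `(R ^ 2 -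
    -- 1) * w`, and `R ^ 2 - 1 = r * (r + 2)` for `r = R - 1`.
    nlinarith [mul_le_mul_of_nonneg_left hw (show (0 : ℝ) ≤ R ^ 2 - 1 by nlinarith)]
  · intro k
    simp only [hr]
    have p3 : 0 < c (2 * (k + N) + 1 + 2) := hc.pos hc1 _
    have hlarge := (hN (2 * (k + N) + 1) (by omega)).1
    have hd' := (hN (2 * (k + N + 1) + 1) (by omega)).2
    have e : (4 : ℝ) ^ (N + 1) * 4 ^ k = dyadicK (2 * (k + N) + 1 + 1) := by
      unfold dyadicK
      rw [show 2 * (k + N) + 1 + 1 = 2 * (N + 1 + k) by ring, pow_mul, ← pow_add]; norm_num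
    rw [e]
    have hk := dyadicK_pos (2 * (k + N) + 1 + 1)
    have : d (2 * (k + N + 1) + 1) / c (2 * (k + N + 1) + 1) ≤ dyadicK (2 * (k + N) + 1 + 1) := by
      change _ / c (2 * (k + N) + 1 + 2) ≤ _
      rw [div_le_iff₀ p3]
      linarith
    linarith

/-- A profile with positive first entry is determined by vanishing at infinity. -/
theorem eq_of_tendsto (hc : IsDyadicProfile c) (hd : IsDyadicProfile d) (hc1 : 0 < c 1)
    (hd1 : 0 < d 1) (hcs : Tendsto c atTop (𝓝 0)) (hds : Tendsto d atTop (𝓝 0)) : c = d := by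
  have h1 : c 1 = d 1 := le_antisymm
    (not_lt.1 (hd.not_lt_of_tendsto hc hd1 hc1 hds hcs))
    (not_lt.1 (hc.not_lt_of_tendsto hd hc1 hd1 hcs hds))
  have key : ∀ n, c n = d n ∧ c (n + 1) = d (n + 1) := by
    intro n
    induction n with
    | zero => exact ⟨hc.zero.trans hd.zero.symm, h1⟩
    | succ n ih =>
      refine ⟨ih.2, ?_⟩
      change c (n + 2) = d (n + 2)
      rw [hc.succ_succ hc1, hd.succ_succ hd1, ih.1, ih.2]
  exact funext fun n => (key n).1

end IsDyadicProfile

/-! ### Existence of a finite-energy profile by shooting. -/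

lemma eq_of_mem_uIcc_of_abs_sub_le {u v y z : ℝ} (hy : y ∈ uIcc u v) (hz : z ∈ uIcc y v)
    (h : |u - v| ≤ |z - v|) : z = y := by
  rw [mem_uIcc] at hy hz
  rcases hy with ⟨h1, h2⟩ | ⟨h1, h2⟩ <;> rcases hz with ⟨h3, h4⟩ | ⟨h3, h4⟩ <;>
    rcases abs_cases (u - v) with ⟨h5, h5'⟩ | ⟨h5, h5'⟩ <;>
    rcases abs_cases (z - v) with ⟨h6, h6'⟩ | ⟨h6, h6'⟩ <;> linarith

/-- Between two points where a continuous function is below `p` and above `q` there is an interval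
on which it runs exactly from `p` to `q`. -/
lemma exists_uIcc_between {f : ℝ → ℝ} {a b p q : ℝ} (hf : ContinuousOn f (uIcc a b))
    (hpq : p ≤ q) (ha : f a ≤ p) (hb : q ≤ f b) :
    ∃ u v, uIcc u v ⊆ uIcc a b ∧ f u = p ∧ f v = q ∧ ∀ y ∈ uIcc u v, f y ∈ Icc p q := by
  have hsub : uIcc p q ⊆ uIcc (f a) (f b) := by
    rw [uIcc_of_le hpq, uIcc_of_le (ha.trans (hpq.trans hb))]
    exact Icc_subset_Icc ha hb
  obtain ⟨u₀, hu₀, hfu₀⟩ := intermediate_value_uIcc hf (hsub left_mem_uIcc)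
  obtain ⟨v₀, hv₀, hfv₀⟩ := intermediate_value_uIcc hf (hsub right_mem_uIcc)
  have hcl : ∀ s : ℝ, IsCompact (uIcc a b ∩ f ⁻¹' {s}) := fun s =>
    isCompact_uIcc.of_isClosed_subset
      (hf.preimage_isClosed_of_isClosed isClosed_Icc isClosed_singleton) inter_subset_left
  -- Take the closest pair with values `p` and `q`. If `f` left `[p, q]` between them, the
  -- intermediate value theorem would give a closer pair.
  obtain ⟨⟨u, v⟩, ⟨⟨hu, hfu⟩, ⟨hv, hfv⟩⟩, hmin⟩ :=
    ((hcl p).prod (hcl q)).exists_isMinOn ⟨(u₀, v₀), ⟨hu₀, hfu₀⟩, ⟨hv₀, hfv₀⟩⟩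
      (f := fun z : ℝ × ℝ => |z.1 - z.2|) (by fun_prop)
  have huv : uIcc u v ⊆ uIcc a b := uIcc_subset_uIcc hu hv
  simp only [mem_preimage, mem_singleton_iff] at hfu hfv
  refine ⟨u, v, huv, hfu, hfv, fun y hy => ⟨?_, ?_⟩⟩
  · by_contra! hlt
    have hyv : uIcc y v ⊆ uIcc u v := uIcc_subset_uIcc hy right_mem_uIcc
    obtain ⟨z, hz, hfz⟩ := intermediate_value_uIcc (hf.mono (hyv.trans huv))
      (show p ∈ uIcc (f y) (f v) by
        rw [hfv, uIcc_of_le (hlt.le.trans hpq)]; exact ⟨hlt.le, hpq⟩)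
    have h1 : |u - v| ≤ |z - v| := isMinOn_iff.1 hmin (z, v) ⟨⟨huv (hyv hz), hfz⟩, ⟨hv, hfv⟩⟩
    rw [eq_of_mem_uIcc_of_abs_sub_le hy hz h1] at hfz
    exact hlt.ne hfz
  · by_contra! hlt
    have hyv : uIcc y u ⊆ uIcc u v := uIcc_subset_uIcc hy left_mem_uIcc
    obtain ⟨z, hz, hfz⟩ := intermediate_value_uIcc (hf.mono (hyv.trans huv))
      (show q ∈ uIcc (f y) (f u) by
        rw [hfu, uIcc_of_ge (hpq.trans hlt.le)]; exact ⟨hpq, hlt.le⟩)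
    have h1 : |u - v| ≤ |u - z| := isMinOn_iff.1 hmin (u, z) ⟨⟨hu, hfu⟩, ⟨huv (hyv hz), hfz⟩⟩
    rw [abs_sub_comm u v, abs_sub_comm u z] at h1
    rw [uIcc_comm] at hy
    rw [eq_of_mem_uIcc_of_abs_sub_le hy hz h1] at hfz
    exact hlt.ne' hfz

/-- The profile with first entry `x`. -/
noncomputable def dyadicProfile (x : ℝ) : ℕ → ℝ
  | 0 => 0
  | 1 => x
  | n + 2 => 1 / dyadicK (n + 1) + dyadicProfile x n ^ 2 / (2 * dyadicProfile x (n + 1))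

section dyadicProfile

variable {x : ℝ}

lemma dyadicProfile_zero (x : ℝ) : dyadicProfile x 0 = 0 := by rw [dyadicProfile]

lemma dyadicProfile_one (x : ℝ) : dyadicProfile x 1 = x := by rw [dyadicProfile]

lemma dyadicProfile_succ_succ (x : ℝ) (n : ℕ) : dyadicProfile x (n + 2) =
    1 / dyadicK (n + 1) + dyadicProfile x n ^ 2 / (2 * dyadicProfile x (n + 1)) := by
  rw [dyadicProfile]

lemma dyadicProfile_pos (hx : 0 < x) (n : ℕ) : 0 < dyadicProfile x (n + 1) := by
  induction n with
  | zero => rwa [dyadicProfile_one]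
  | succ n ih =>
    have := dyadicK_pos (n + 1)
    rw [dyadicProfile_succ_succ]
    positivity

lemma isDyadicProfile_dyadicProfile (hx : 0 < x) : IsDyadicProfile (dyadicProfile x) where
  zero := dyadicProfile_zero x
  recurrence n := by
    have hk := dyadicK_pos n
    have hp := dyadicProfile_pos hx n
    rw [dyadicProfile_succ_succ, dyadicK_succ]
    field_simp

lemma continuousOn_dyadicProfile (n : ℕ) :
    ContinuousOn (fun x => dyadicProfile x n) (Ioi 0) := by
  have key : ContinuousOn (fun x => dyadicProfile x n) (Ioi 0) ∧
      ContinuousOn (fun x => dyadicProfile x (n + 1)) (Ioi 0) := by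
    induction n with
    | zero =>
      simp only [dyadicProfile_zero, zero_add, dyadicProfile_one]
      exact ⟨continuousOn_const, continuousOn_id⟩
    | succ n ih =>
      refine ⟨ih.2, ?_⟩
      simp only [add_assoc, Nat.reduceAdd, dyadicProfile_succ_succ]
      refine continuousOn_const.add ((ih.1.pow 2).div (continuousOn_const.mul ih.2) ?_)
      intro y hy
      have := dyadicProfile_pos hy n
      positivity
  exact key.1

lemma dyadicProfile_two (x : ℝ) : dyadicProfile x 2 = 1 / 2 := by
  rw [dyadicProfile_succ_succ, dyadicProfile_zero]; norm_num [dyadicK]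

lemma dyadicProfile_three (x : ℝ) : dyadicProfile x 3 = 1 / 4 + x ^ 2 := by
  rw [dyadicProfile_succ_succ, dyadicProfile_two, dyadicProfile_one]; norm_num [dyadicK]

/-- Parameters in `[0.3, 0.55]` for which the ratios of consecutive entries stay in `[0.7, 0.99]`
up to index `m + 4`. -/
def dyadicShootingSet (m : ℕ) : Set ℝ :=
  {x ∈ Icc (3 / 10 : ℝ) (11 / 20) | ∀ j ≤ m,
    dyadicProfile x (j + 4) / dyadicProfile x (j + 3) ∈ Icc (7 / 10 : ℝ) (99 / 100)}

/-- Since `7/10 > 1/2`, this keeps the entries large against `1 / dyadicK (m + 4)`. The constant is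
`17/50 = 1/4 + (3/10)²`. -/
lemma le_dyadicProfile_of_mem (m : ℕ) (hx : x ∈ dyadicShootingSet m) :
    (17 / 50) * (7 / 10) ^ m ≤ dyadicProfile x (m + 3) := by
  obtain ⟨⟨hx1, hx2⟩, hx3⟩ := hx
  have key : ∀ j ≤ m, (17 / 50) * (7 / 10) ^ j ≤ dyadicProfile x (j + 3) := by
    intro j
    induction j with
    | zero => intro; rw [dyadicProfile_three]; nlinarith
    | succ j ih =>
      intro hj
      have h := ih (by omega)
      have h2 := (hx3 j (by omega)).1
      rw [le_div_iff₀ (dyadicProfile_pos (by linarith) _)] at h2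
      rw [pow_succ]
      change _ ≤ dyadicProfile x (j + 4)
      linarith
  exact key m le_rfl

lemma continuousOn_dyadicProfile_ratio (m : ℕ) {s : Set ℝ} (hs : s ⊆ Icc (3 / 10 : ℝ) (11 / 20)) :
    ContinuousOn (fun x => dyadicProfile x (m + 4) / dyadicProfile x (m + 3)) s := by
  have hs' : s ⊆ Ioi 0 := fun y hy => by have := (hs hy).1; simp only [mem_Ioi]; linarith
  exact ((continuousOn_dyadicProfile _).mono hs').div ((continuousOn_dyadicProfile _).mono hs')
    fun y hy => (dyadicProfile_pos (hs' hy) _).ne'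

/-- The next ratio is `1 / (2ρ²)` plus a small positive term. Thus `ρ = 0.7` gives more than `0.99`
and `ρ = 0.99` gives at most `0.7`: the image covers `[0.7, 0.99]` again with the endpoints swapped,
and a subinterval maps into it. -/
lemma exists_uIcc_subset_dyadicShootingSet (m : ℕ) : ∃ a b, uIcc a b ⊆ dyadicShootingSet m ∧
    dyadicProfile a (m + 4) / dyadicProfile a (m + 3) = (7 / 10) ∧
    dyadicProfile b (m + 4) / dyadicProfile b (m + 3) = (99 / 100) := by
  induction m with
  | zero =>
    have hs : uIcc (11 / 20 : ℝ) (3 / 10) ⊆ Icc (3 / 10 : ℝ) (11 / 20) := by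
      rw [uIcc_of_ge (by norm_num)]
    obtain ⟨u, v, huv, hu, hv, h⟩ := exists_uIcc_between (p := 7 / 10) (q := 99 / 100)
      (continuousOn_dyadicProfile_ratio 0 hs) (by norm_num)
      (by
        simp only [zero_add]
        rw [dyadicProfile_succ_succ, dyadicProfile_three, dyadicProfile_two]; norm_num [dyadicK])
      (by
        simp only [zero_add]
        rw [dyadicProfile_succ_succ, dyadicProfile_three, dyadicProfile_two]; norm_num [dyadicK])
    refine ⟨u, v, fun y hy => ⟨hs (huv hy), fun j hj => ?_⟩, hu, hv⟩
    obtain rfl : j = 0 := by omega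
    exact h y hy
  | succ m ih =>
    obtain ⟨a, b, hab, ha, hb⟩ := ih
    have hs : uIcc b a ⊆ Icc (3 / 10 : ℝ) (11 / 20) := fun y hy => (hab (uIcc_comm b a ▸ hy)).1
    have hbm := hab right_mem_uIcc
    have ham := hab left_mem_uIcc
    have pa : ∀ n, 0 < dyadicProfile a (n + 1) :=
      dyadicProfile_pos (by have := ham.1.1; linarith)
    have pb : ∀ n, 0 < dyadicProfile b (n + 1) :=
      dyadicProfile_pos (by have := hbm.1.1; linarith)
    have pa3 := pa (m + 2)
    have pa4 := pa (m + 3)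
    have pb3 := pb (m + 2)
    have pb4 := pb (m + 3)
    have hlow := le_dyadicProfile_of_mem m hbm
    have hk := dyadicK_pos (m + 4)
    simp only [add_assoc, Nat.reduceAdd] at pa3 pa4 pb3 pb4
    rw [div_eq_iff pa3.ne'] at ha
    rw [div_eq_iff pb3.ne'] at hb
    have hkle : 1 / dyadicK (m + 4) ≤ (1 / 16) * (7 / 10) ^ m := by
      have : 1 / dyadicK (m + 4) = (1 / 16) * (1 / 2) ^ m := by
        rw [dyadicK_add]; unfold dyadicK
        rw [one_div_pow]; field_simp; norm_num
      rw [this]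
      exact mul_le_mul_of_nonneg_left (pow_le_pow_left₀ (by norm_num) (by norm_num) m) (by norm_num)
    obtain ⟨u, v, huv, hu, hv, h⟩ := exists_uIcc_between (a := b) (b := a) (p := 7 / 10) (q := 99 / 100)
      (continuousOn_dyadicProfile_ratio (m + 1) hs) (by norm_num)
      (by
        simp only [add_assoc, Nat.reduceAdd]
        rw [div_le_iff₀ pb4, dyadicProfile_succ_succ b (m + 3)]
        simp only [add_assoc, Nat.reduceAdd]
        rw [hb]
        have : dyadicProfile b (m + 3) ^ 2 / (2 * ((99 / 100) * dyadicProfile b (m + 3)))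
            = dyadicProfile b (m + 3) * (50 / 99) := by field_simp; norm_num
        rw [this]
        have h7 : (0 : ℝ) < (7 / 10) ^ m := by positivity
        linarith)
      (by
        simp only [add_assoc, Nat.reduceAdd]
        rw [le_div_iff₀ pa4, dyadicProfile_succ_succ a (m + 3)]
        simp only [add_assoc, Nat.reduceAdd]
        rw [ha]
        have : dyadicProfile a (m + 3) ^ 2 / (2 * ((7 / 10) * dyadicProfile a (m + 3)))
            = dyadicProfile a (m + 3) * (5 / 7) := by field_simp; norm_num
        rw [this]
        have : 0 < 1 / dyadicK (m + 4) := by positivity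
        linarith)
    refine ⟨u, v, fun y hy => ⟨hs (huv hy), fun j hj => ?_⟩, hu, hv⟩
    rcases Nat.lt_or_eq_of_le hj with hj | rfl
    · exact (hab (uIcc_comm b a ▸ huv hy)).2 j (by omega)
    · exact h y hy

lemma exists_forall_mem_dyadicShootingSet : ∃ x, ∀ m, x ∈ dyadicShootingSet m := by
  have hclosed : ∀ m, IsClosed (dyadicShootingSet m) := by
    intro m
    have : dyadicShootingSet m = ⋂ j ∈ Iic m, (Icc (3 / 10 : ℝ) (11 / 20) ∩
        (fun x => dyadicProfile x (j + 4) / dyadicProfile x (j + 3)) ⁻¹' Icc (7 / 10 : ℝ) (99 / 100)) := by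
      ext x
      simp only [dyadicShootingSet, mem_ofPred_eq, mem_iInter, mem_Iic, mem_inter_iff, mem_preimage]
      exact ⟨fun h j hj => ⟨h.1, h.2 j hj⟩, fun h => ⟨(h 0 (Nat.zero_le _)).1, fun j hj => (h j hj).2⟩⟩
    rw [this]
    exact isClosed_biInter fun j _ => (continuousOn_dyadicProfile_ratio j
      subset_rfl).preimage_isClosed_of_isClosed isClosed_Icc isClosed_Icc
  obtain ⟨x, hx⟩ := IsCompact.nonempty_iInter_of_sequence_nonempty_isCompact_isClosed
    dyadicShootingSet (fun m x hx => ⟨hx.1, fun j hj => hx.2 j (by omega)⟩)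
    (fun m => by
      obtain ⟨a, b, hab, -⟩ := exists_uIcc_subset_dyadicShootingSet m
      exact ⟨a, hab left_mem_uIcc⟩)
    (isCompact_Icc.of_isClosed_subset (hclosed 0) fun x hx => hx.1) hclosed
  exact ⟨x, fun m => mem_iInter.1 hx m⟩

/-- There is a positive profile of finite energy. -/
theorem exists_isDyadicProfile_summable :
    ∃ c, IsDyadicProfile c ∧ 0 < c 1 ∧ Summable fun n => c n ^ 2 := by
  obtain ⟨x, hx⟩ := exists_forall_mem_dyadicShootingSet
  have hx0 : 0 < x := by have := (hx 0).1.1; linarith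
  have hp := dyadicProfile_pos hx0
  refine ⟨dyadicProfile x, isDyadicProfile_dyadicProfile hx0, by rwa [dyadicProfile_one], ?_⟩
  refine summable_of_ratio_norm_eventually_le (r := 99 / 100) (by norm_num) ?_
  filter_upwards [eventually_ge_atTop 3] with n hn
  obtain ⟨m, rfl⟩ := Nat.exists_eq_add_of_le' hn
  have h := ((hx m).2 m le_rfl).2
  rw [div_le_iff₀ (hp _)] at h
  have h3 : 0 < dyadicProfile x (m + 3) := hp _
  have h4 : 0 < dyadicProfile x (m + 4) := hp _
  simp only [norm_pow, Real.norm_eq_abs, sq_abs, add_assoc, Nat.reduceAdd]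
  nlinarith

end dyadicProfile

/-! ### Leading zeros, and passage between profiles and solutions. -/

namespace IsDyadicProfile

variable {a b : ℕ → ℝ} {n₀ : ℕ}

/-- Prepending `n₀` zeros to a profile, with the appropriate rescaling. -/
lemma shift (hc : IsDyadicProfile a) (n₀ : ℕ) :
    IsDyadicProfile fun n => a (n - n₀) / dyadicK n₀ where
  zero := by simp [hc.zero]
  recurrence n := by
    have hk := dyadicK_pos n₀
    -- Truncated subtraction sends every index up to `n₀` to `0`, where `a` vanishes.
    rcases lt_or_ge n n₀ with h | h
    · rw [Nat.sub_eq_zero_of_le h, Nat.sub_eq_zero_of_le h.le, hc.zero]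
      simp
    · obtain ⟨j, rfl⟩ := Nat.exists_eq_add_of_le h
      have h1 := hc.recurrence j
      rw [show n₀ + j + 1 - n₀ = j + 1 by omega, show n₀ + j + 2 - n₀ = j + 2 by omega,
        show n₀ + j - n₀ = j by omega, add_assoc n₀ j 1, dyadicK_add n₀ (j + 1),
        dyadicK_add n₀ j]
      field_simp
      linarith

lemma leading_eq_zero (ha : IsDyadicProfile a) (hl : HasLeadingIndex n₀ a) : a n₀ = 0 := by
  rcases Nat.eq_zero_or_pos n₀ with rfl | h
  · exact ha.zero
  · exact hl.1 n₀ h le_rfl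

/-- Dropping the leading zeros of a profile. -/
lemma unshift (ha : IsDyadicProfile a) (hl : HasLeadingIndex n₀ a) :
    IsDyadicProfile fun n => dyadicK n₀ * a (n₀ + n) where
  zero := by simp [ha.leading_eq_zero hl]
  recurrence n := by
    have h := ha.recurrence (n₀ + n)
    rw [add_assoc n₀ n 1, add_assoc n₀ n 2, dyadicK_add n₀ (n + 1), dyadicK_add n₀ n] at h
    linear_combination dyadicK n₀ * h

/-- Profiles of finite energy with given number of leading zeros are unique. -/
theorem eq_of_hasLeadingIndex (ha : IsDyadicProfile a) (hb : IsDyadicProfile b)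
    (hla : HasLeadingIndex n₀ a) (hlb : HasLeadingIndex n₀ b) (ha0 : 0 ≤ a (n₀ + 1))
    (hb0 : 0 ≤ b (n₀ + 1)) (has : Summable fun n => a (n + 1) ^ 2)
    (hbs : Summable fun n => b (n + 1) ^ 2) : a = b := by
  have htend : ∀ {c : ℕ → ℝ}, Summable (fun n => c (n + 1) ^ 2) →
      Tendsto (fun n => dyadicK n₀ * c (n₀ + n)) atTop (𝓝 0) := by
    intro c hs
    have h1 : Tendsto (fun n => c n ^ 2) atTop (𝓝 0) :=
      ((summable_nat_add_iff (f := fun n => c n ^ 2) 1).1 hs).tendsto_atTop_zero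
    have h2 : Tendsto c atTop (𝓝 0) := by
      have := (Real.continuous_sqrt.tendsto 0).comp h1
      rw [Real.sqrt_zero] at this
      refine (tendsto_zero_iff_abs_tendsto_zero _).2 (this.congr fun n => ?_)
      simp [Real.sqrt_sq_eq_abs]
    have h3 : Tendsto (fun n => n₀ + n) atTop atTop := by
      simpa [add_comm] using tendsto_add_atTop_nat n₀
    simpa using (h2.comp h3).const_mul (dyadicK n₀)
  have hk := dyadicK_pos n₀
  have h := (ha.unshift hla).eq_of_tendsto (hb.unshift hlb)
    (mul_pos hk (ha0.lt_of_ne' hla.2)) (mul_pos hk (hb0.lt_of_ne' hlb.2)) (htend has) (htend hbs)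
  funext n
  rcases le_or_gt n n₀ with hn | hn
  · rcases Nat.eq_zero_or_pos n with rfl | hn0
    · rw [ha.zero, hb.zero]
    · rw [hla.1 n hn0 hn, hlb.1 n hn0 hn]
  · obtain ⟨j, rfl⟩ := Nat.exists_eq_add_of_lt hn
    exact mul_left_cancel₀ hk.ne' (congrFun h (j + 1))

/-- Profiles yield solutions on every interval that avoids the singular time. -/
lemma isDyadicSolutionOn (ha : IsDyadicProfile a) {I : Set ℝ} {τ : ℝ} (hτ : τ ∉ I) :
    IsDyadicSolutionOn I fun n t => a n / (t - τ) where
  zero t _ := by simp [ha.zero]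
  contDiffOn n := contDiffOn_const.div (by fun_prop)
    fun t ht => sub_ne_zero.2 fun h => hτ (h ▸ ht)
  equation n t ht := by
    have hne : t - τ ≠ 0 := sub_ne_zero.2 fun h => hτ (h ▸ ht)
    have h := ((hasDerivAt_const t (a (n + 1))).div ((hasDerivAt_id t).sub_const τ)
      hne).hasDerivWithinAt (s := I)
    refine h.congr_deriv ?_
    have hr := ha.recurrence n
    simp only [id]
    field_simp
    linarith

end IsDyadicProfile

lemma hasFiniteEnergyOn_div_sub {a : ℕ → ℝ} (has : Summable fun n => a (n + 1) ^ 2) (I : Set ℝ) (τ : ℝ) :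
    HasFiniteEnergyOn I fun n t => a n / (t - τ) := fun t _ => by
  simpa only [div_pow] using has.div_const ((t - τ) ^ 2)

/-- The coefficients of a solution `b_n / (t - τ)` form a profile, after setting `b_0 = 0`. -/
lemma IsDyadicSolutionOn.isDyadicProfile {I : Set ℝ} {X : ℕ → ℝ → ℝ} {τ s : ℝ} {b : ℕ → ℝ}
    (hX : IsDyadicSolutionOn I X) (hs : s ∈ I) (hI : UniqueDiffWithinAt ℝ I s) (hτ : s ≠ τ)
    (hb : ∀ n, 1 ≤ n → ∀ t ∈ I, X n t = b n / (t - τ)) :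
    IsDyadicProfile (Function.update b 0 0) where
  zero := by simp
  recurrence n := by
    have hne : s - τ ≠ 0 := sub_ne_zero.2 hτ
    have hval : ∀ n, X n s = Function.update b 0 0 n / (s - τ) := by
      intro n
      rcases Nat.eq_zero_or_pos n with rfl | hn
      · simp [hX.zero s hs]
      · rw [hb n hn s hs, Function.update_of_ne hn.ne']
    have h1 := hX.equation n s hs
    have h2 : HasDerivWithinAt (X (n + 1)) _ I s :=
      (((hasDerivAt_const s (b (n + 1))).div ((hasDerivAt_id s).sub_const τ)
        hne).hasDerivWithinAt (s := I)).congr (fun t ht => hb (n + 1) (by omega) t ht)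
        (hb (n + 1) (by omega) s hs)
    -- Comparing the two derivatives at the single time `s` and clearing `(s - τ) ^ 2` yields the
    -- recurrence.
    have h := hI.eq_deriv _ h1 h2
    rw [hval, hval, hval] at h
    have e : b (n + 1) = Function.update b 0 0 (n + 1) := by simp
    rw [e] at h
    simp only [id] at h
    field_simp at h
    linarith

lemma HasLeadingIndex.update_zero {n₀ : ℕ} {b : ℕ → ℝ} (h : HasLeadingIndex n₀ b) :
    HasLeadingIndex n₀ (Function.update b 0 0) :=
  ⟨fun n h1 h2 => by rw [Function.update_of_ne (by omega)]; exact h.1 n h1 h2, by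
    rw [Function.update_of_ne (by omega)]; exact h.2⟩

/-- Uniqueness among the solutions of the form `b_n / (t - τ)`. -/
lemma IsSelfSimilarSolutionWith.coeff_eq {I : Set ℝ} {X : ℕ → ℝ → ℝ} {τ s : ℝ} {n₀ : ℕ}
    {a b : ℕ → ℝ} (ha : IsDyadicProfile a) (hla : HasLeadingIndex n₀ a) (ha0 : 0 ≤ a (n₀ + 1))
    (has : Summable fun n => a (n + 1) ^ 2) (hX : IsSelfSimilarSolutionWith I τ n₀ b X)
    (hs : s ∈ I) (hI : UniqueDiffWithinAt ℝ I s) (hτ : s ≠ τ)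
    (hsign : 0 ≤ X (n₀ + 1) s * (s - τ)) :
    (∀ n, 1 ≤ n → b n = a n) ∧ ∀ n, ∀ t ∈ I, X n t = a n / (t - τ) := by
  obtain ⟨hsol, hen, hl, hform⟩ := hX
  have hne : s - τ ≠ 0 := sub_ne_zero.2 hτ
  have hval := hform (n₀ + 1) (by omega) s hs
  have hbs : Summable fun n => b (n + 1) ^ 2 := by
    refine ((hen s hs).mul_right ((s - τ) ^ 2)).congr fun n => ?_
    rw [hform (n + 1) (by omega) s hs]
    field_simp
  -- `hsign` says `0 ≤ b (n₀ + 1)`; it covers negative solutions before `τ` and positive ones after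
  -- `τ`.
  have heq := (hsol.isDyadicProfile hs hI hτ hform).eq_of_hasLeadingIndex ha hl.update_zero hla
    (by
      rw [Function.update_of_ne (by omega)]
      rw [hval, div_mul_cancel₀ _ hne] at hsign
      exact hsign) ha0 (by simpa using hbs) has
  have h1 : ∀ n, 1 ≤ n → b n = a n := fun n hn => by
    rw [← heq, Function.update_of_ne (by omega)]
  refine ⟨h1, fun n t ht => ?_⟩
  rcases Nat.eq_zero_or_pos n with rfl | hn
  · rw [hsol.zero t ht, ha.zero, zero_div]
  · rw [hform n hn t ht, h1 n hn]

/-! ### The Riccati equation and general self-similar solutions. -/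

/-- A non-positive solution of `ψ' = -μ ψ²` that starts at zero vanishes. -/
lemma eq_zero_of_riccati {ψ : ℝ → ℝ} {μ T : ℝ} (hμ : 0 ≤ μ)
    (hd : ∀ t ∈ Ico 0 T, HasDerivWithinAt ψ (-μ * ψ t ^ 2) (Ico 0 T) t)
    (hneg : ∀ t ∈ Ico 0 T, ψ t ≤ 0) (h0 : ψ 0 = 0) : ∀ t ∈ Ico 0 T, ψ t = 0 := by
  intro s hs
  have hsub : Icc 0 s ⊆ Ico 0 T := fun y hy => ⟨hy.1, hy.2.trans_lt hs.2⟩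
  have hc : ContinuousOn ψ (Icc 0 s) := fun y hy =>
    ((hd y (hsub hy)).continuousWithinAt).mono hsub
  obtain ⟨M, hM⟩ := (isCompact_Icc.image_of_continuousOn hc).isBounded.exists_norm_le
  -- With `-ψ ≤ M`, this integrating factor makes the derivative nonnegative, so `ψ` cannot fall
  -- below zero.
  have hmono : MonotoneOn (fun t => ψ t * Real.exp (-(μ * M) * t)) (Icc 0 s) := by
    refine monotoneOn_of_hasDerivWithinAt_nonneg (convex_Icc 0 s)
      (f' := fun t => -μ * ψ t ^ 2 * Real.exp (-(μ * M) * t) +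
        ψ t * (Real.exp (-(μ * M) * t) * (-(μ * M) * 1)))
      (hc.mul (by fun_prop)) (fun t ht => ?_) (fun t ht => ?_)
    · exact ((hd t (hsub (interior_subset ht))).mono (interior_subset.trans hsub)).mul
        ((((hasDerivAt_id t).const_mul (-(μ * M))).exp).hasDerivWithinAt)
    · have ht' := interior_subset ht
      have h1 := hneg t (hsub ht')
      have h2 : -ψ t ≤ M := (neg_le_abs _).trans (hM _ (mem_image_of_mem ψ ht'))
      have : -μ * ψ t ^ 2 * Real.exp (-(μ * M) * t) +
          ψ t * (Real.exp (-(μ * M) * t) * (-(μ * M) * 1))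
          = μ * (-ψ t) * (M + ψ t) * Real.exp (-(μ * M) * t) := by ring
      rw [this]
      have : 0 ≤ M + ψ t := by linarith
      have : 0 ≤ -ψ t := by linarith
      positivity
  have h := hmono (left_mem_Icc.2 hs.1) (right_mem_Icc.2 hs.1) hs.1
  simp only [h0, zero_mul] at h
  exact le_antisymm (hneg s hs) (nonneg_of_mul_nonneg_left h (Real.exp_pos _))

/-- Explicit form of the non-zero non-positive solutions of `ψ' = -μ ψ²`. -/
lemma inv_eq_of_riccati {ψ : ℝ → ℝ} {μ T : ℝ} (hμ : 0 ≤ μ)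
    (hd : ∀ t ∈ Ico 0 T, HasDerivWithinAt ψ (-μ * ψ t ^ 2) (Ico 0 T) t)
    (h0 : ψ 0 < 0) : ∀ t ∈ Ico 0 T, ψ t < 0 ∧ (ψ t)⁻¹ = (ψ 0)⁻¹ + μ * t := by
  intro s hs
  have hT : (0 : ℝ) ∈ Ico 0 T := ⟨le_rfl, hs.1.trans_lt hs.2⟩
  have hneg : ∀ t ∈ Ico 0 T, ψ t < 0 := by
    have hanti : AntitoneOn ψ (Ico 0 T) := by
      refine antitoneOn_of_hasDerivWithinAt_nonpos (convex_Ico 0 T)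
        (f' := fun t => -μ * ψ t ^ 2) (fun t ht => (hd t ht).continuousWithinAt)
        (fun t ht => (hd t (interior_subset ht)).mono interior_subset) fun t _ => ?_
      have := mul_nonneg hμ (sq_nonneg (ψ t))
      linarith
    exact fun t ht => (hanti hT ht ht.1).trans_lt h0
  refine ⟨hneg s hs, ?_⟩
  have hderiv : ∀ t ∈ Ico 0 T, HasDerivWithinAt (fun t => (ψ t)⁻¹ - μ * t) 0 (Ico 0 T) t := by
    intro t ht
    have hne := (hneg t ht).ne
    refine (((hd t ht).inv hne).sub
      (((hasDerivAt_id t).const_mul μ).hasDerivWithinAt)).congr_deriv ?_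
    field_simp
    ring
  have hconst := (convex_Ico 0 T).is_const_of_fderivWithin_eq_zero (𝕜 := ℝ)
    (f := fun t => (ψ t)⁻¹ - μ * t) (fun t ht => (hderiv t ht).differentiableWithinAt)
    (fun t ht => by
      rw [((hderiv t ht).hasFDerivWithinAt).fderivWithin
        ((uniqueDiffOn_Ico 0 T) t ht)]
      ext; simp) hs hT
  simp only [mul_zero, sub_zero] at hconst
  linarith

/-- A negative finite energy self-similar solution that cannot be extended is of the form
`b_n / (t - τ)`, with `T ≤ τ`. -/
lemma IsMaximalNegativeSelfSimilar.exists_form {T : ℝ} (hT : 0 < T) {n₀ : ℕ} {Z : ℕ → ℝ → ℝ}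
    (hZ : IsMaximalNegativeSelfSimilar T n₀ Z) :
    ∃ τ, T ≤ τ ∧ ∃ b, IsSelfSimilarSolutionWith (Ico 0 T) τ n₀ b Z := by
  obtain ⟨⟨hsol, hen, b, φ, hl, hform⟩, hneg, hmax⟩ := hZ
  have h0T : (0 : ℝ) ∈ Ico 0 T := ⟨le_rfl, hT⟩
  set m := n₀ + 1 with hm
  have hbm : b m ≠ 0 := hl.2
  have hprev : ∀ t ∈ Ico 0 T, Z n₀ t = 0 := by
    intro t ht
    rcases Nat.eq_zero_or_pos n₀ with h | h
    · rw [h]; exact hsol.zero t ht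
    · rw [hform n₀ h t ht, hl.1 n₀ h le_rfl, zero_mul]
  -- `φ` has no assumed regularity, so the differentiable `Z m` replaces it.
  have hratio : ∀ n, 1 ≤ n → ∀ t ∈ Ico 0 T, Z n t = b n / b m * Z m t := by
    intro n hn t ht
    rw [hform n hn t ht, hform m (by omega) t ht]
    field_simp
  have hmneg : ∀ t ∈ Ico 0 T, Z m t ≤ 0 := hneg m (by omega)
  set μ := dyadicK m * (b (m + 1) / b m) with hμdef
  have hK := dyadicK_pos m
  have hric : ∀ t ∈ Ico 0 T, HasDerivWithinAt (Z m) (-μ * Z m t ^ 2) (Ico 0 T) t := by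
    intro t ht
    refine (hsol.equation n₀ t ht).congr_deriv ?_
    rw [hprev t ht, hratio (n₀ + 2) (by omega) t ht]
    ring
  have hμ : ∀ t ∈ Ico 0 T, Z m t ≠ 0 → 0 ≤ μ := by
    intro t ht hne
    have h1 := hneg (m + 1) (by omega) t ht
    rw [hratio (m + 1) (by omega) t ht] at h1
    exact mul_nonneg hK.le (nonneg_of_mul_nonpos_left h1 ((hmneg t ht).lt_of_ne hne))
  have hzero : Z m 0 < 0 := by
    refine (hmneg 0 h0T).lt_of_ne fun h0 => ?_
    -- If `Z m` starts at zero, `Z` vanishes, and the zero solution (`φ = 0`) extends it, against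
    -- maximality.
    have hall : ∀ t ∈ Ico 0 T, Z m t = 0 := by
      by_contra! h
      obtain ⟨t, ht, hne⟩ := h
      exact hne (eq_zero_of_riccati (hμ t ht hne) hric hmneg h0 t ht)
    refine hmax ⟨T + 1, by linarith, fun _ _ => 0, ⟨⟨fun _ _ => rfl, fun _ => contDiffOn_const,
      fun n t _ => ?_⟩, fun t _ => ?_, b, fun _ => 0, hl, fun n _ t _ => ?_⟩, fun n _ t _ => le_rfl,
      fun n t ht => ?_⟩
    · simpa using hasDerivWithinAt_const t (Ico 0 (T + 1)) (0 : ℝ)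
    · simp
    · simp
    · rcases Nat.eq_zero_or_pos n with rfl | hn
      · exact (hsol.zero t ht).symm
      · rw [hratio n hn t ht, hall t ht, mul_zero]
  -- If `μ = 0`, component `m + 1` vanishes identically, yet its equation has the positive input
  -- `dyadicK m * Z m 0 ^ 2`.
  have hμ0 : μ ≠ 0 := by
    intro h
    have hb : b (m + 1) / b m = 0 := (mul_eq_zero.1 h).resolve_left hK.ne'
    have hnext : ∀ t ∈ Ico 0 T, Z (m + 1) t = 0 := fun t ht => by
      rw [hratio (m + 1) (by omega) t ht, hb, zero_mul]
    have h1 := ((hasDerivWithinAt_const 0 (Ico 0 T) (0 : ℝ)).congr hnext (hnext 0 h0T))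
    have h2 := ((uniqueDiffOn_Ico 0 T) 0 h0T).eq_deriv _ (hsol.equation m 0 h0T) h1
    rw [hnext 0 h0T, mul_zero, zero_mul, sub_zero] at h2
    have : 0 < dyadicK m * Z m 0 ^ 2 := mul_pos hK (by nlinarith)
    linarith
  have hμpos : 0 < μ := (hμ 0 h0T hzero.ne).lt_of_ne' hμ0
  have hinv := inv_eq_of_riccati hμpos.le hric hzero
  have hτ : ∀ t, (Z m 0)⁻¹ + μ * t = μ * (t - -(Z m 0)⁻¹ / μ) := fun t => by field_simp; ring
  have hτpos : 0 < -(Z m 0)⁻¹ / μ := div_pos (neg_pos.2 (inv_lt_zero.2 hzero)) hμpos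
  set τ := -(Z m 0)⁻¹ / μ with hτdef
  refine ⟨τ, ?_, fun n => b n / (b m * μ), hsol, hen, ⟨fun n h1 h2 => ?_, ?_⟩, fun n hn t ht => ?_⟩
  -- At a time `τ` inside `[0, T)` the inverse of the negative number `Z m τ` would be zero.
  · by_contra! hlt
    obtain ⟨h1, h2⟩ := hinv τ ⟨hτpos.le, hlt⟩
    rw [hτ, sub_self, mul_zero, inv_eq_zero] at h2
    exact h1.ne h2
  · simp [hl.1 n h1 h2]
  · exact div_ne_zero hbm (mul_ne_zero hbm hμ0)
  · have h2 := (hinv t ht).2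
    rw [hτ, inv_eq_iff_eq_inv] at h2
    rw [hratio n hn t ht, h2, mul_inv, div_div, div_mul_eq_mul_div, div_eq_mul_inv, div_eq_mul_inv,
      mul_inv, mul_inv]
    ring

/-! ### Assembly of the theorem. -/

/-- For every `n₀` there is a finite energy profile that starts with `n₀` zeros. -/
lemma exists_isDyadicProfile_hasLeadingIndex (n₀ : ℕ) : ∃ a, IsDyadicProfile a ∧
    HasLeadingIndex n₀ a ∧ (∀ n, n₀ < n → 0 < a n) ∧ Summable fun n => a (n + 1) ^ 2 := by
  obtain ⟨c, hc, hc1, hs⟩ := exists_isDyadicProfile_summable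
  have hk := dyadicK_pos n₀
  have hpos : ∀ n, n₀ < n → 0 < c (n - n₀) / dyadicK n₀ := fun n hn => by
    obtain ⟨j, rfl⟩ := Nat.exists_eq_add_of_lt hn
    rw [show n₀ + j + 1 - n₀ = j + 1 by omega]
    exact div_pos (hc.pos hc1 j) hk
  refine ⟨_, hc.shift n₀, ⟨fun n _ hn => ?_, (hpos _ (by omega)).ne'⟩, hpos, ?_⟩
  · simp [Nat.sub_eq_zero_of_le hn, hc.zero]
  · rw [summable_nat_add_iff (f := fun n => (c (n - n₀) / dyadicK n₀) ^ 2) 1,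
      ← summable_nat_add_iff n₀]
    simpa only [Nat.add_sub_cancel, div_pow] using hs.div_const (dyadicK n₀ ^ 2)

theorem mainTheorem8 (t₀ : ℝ) (ht₀ : 0 < t₀) (n₀ : ℕ) :
    ∃ (a : ℕ → ℝ) (Y : ℕ → ℝ → ℝ),
      -- existence of a negative finite energy self-similar solution on `[0, t₀)`
      (IsSelfSimilarSolutionWith (Ico 0 t₀) t₀ n₀ a Y ∧ IsNegativeOn (Ico 0 t₀) Y) ∧
      -- uniqueness, among solutions of the form `b_n / (t - t₀)`
      (∀ (b : ℕ → ℝ) (Z : ℕ → ℝ → ℝ),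
        IsSelfSimilarSolutionWith (Ico 0 t₀) t₀ n₀ b Z → IsNegativeOn (Ico 0 t₀) Z →
          (∀ n, 1 ≤ n → b n = a n) ∧ ∀ n, ∀ t ∈ Ico 0 t₀, Z n t = Y n t) ∧
      -- the same, among all solutions of the form `b_n φ(t)` with maximal interval `[0, t₀)`
      (IsMaximalNegativeSelfSimilar t₀ n₀ Y ∧
        ∀ Z : ℕ → ℝ → ℝ, IsMaximalNegativeSelfSimilar t₀ n₀ Z →
          ∀ n, ∀ t ∈ Ico 0 t₀, Z n t = Y n t) ∧
      -- every component that does not vanish identically is strictly negative and blows up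
      (∀ n, n₀ < n →
        0 < a n ∧ (∀ t ∈ Ico 0 t₀, Y n t < 0) ∧ Tendsto (Y n) (𝓝[<] t₀) atBot) ∧
      -- `Y(t) = -X(-t)` for the positive finite energy self-similar solution `X` on `(-t₀, ∞)`
      (∃ X : ℕ → ℝ → ℝ,
        IsSelfSimilarSolutionWith (Ioi (-t₀)) (-t₀) n₀ a X ∧ IsPositiveOn (Ioi (-t₀)) X) ∧
      (∀ (b : ℕ → ℝ) (X : ℕ → ℝ → ℝ),
        IsSelfSimilarSolutionWith (Ioi (-t₀)) (-t₀) n₀ b X → IsPositiveOn (Ioi (-t₀)) X →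
          ∀ n, ∀ t ∈ Ico 0 t₀, Y n t = -X n (-t)) := by
  obtain ⟨a, ha, hl, hpos, hs⟩ := exists_isDyadicProfile_hasLeadingIndex n₀
  have hnn : ∀ n, 0 ≤ a n := by
    intro n
    rcases lt_or_ge n₀ n with h | h
    · exact (hpos n h).le
    · rcases Nat.eq_zero_or_pos n with rfl | hn
      · exact ha.zero.ge
      · exact (hl.1 n hn h).ge
  have h0 : (0 : ℝ) ∈ Ico 0 t₀ := ⟨le_rfl, ht₀⟩
  have hsolves : ∀ (I : Set ℝ) (τ : ℝ), τ ∉ I →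
      IsSelfSimilarSolutionWith I τ n₀ a fun n t => a n / (t - τ) := fun I τ hτ =>
    ⟨ha.isDyadicSolutionOn hτ, hasFiniteEnergyOn_div_sub hs I τ, hl, fun _ _ _ _ => rfl⟩
  have hself : ∀ τ : ℝ, IsSelfSimilarSolutionOn (Ico 0 τ) n₀ fun n t => a n / (t - τ) := fun τ =>
    have h := hsolves (Ico 0 τ) τ right_notMem_Ico
    ⟨h.1, h.2.1, a, fun t => (t - τ)⁻¹, hl, fun n _ t _ => div_eq_mul_inv _ _⟩
  have hnegative : ∀ τ : ℝ, IsNegativeOn (Ico 0 τ) fun n t => a n / (t - τ) := fun τ n _ t ht =>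
    div_nonpos_of_nonneg_of_nonpos (hnn n) (by linarith [ht.2])
  have hblow : ∀ n, n₀ < n → Tendsto (fun t => a n / (t - t₀)) (𝓝[<] t₀) atBot := by
    intro n hn
    have h1 : Tendsto (fun t => t - t₀) (𝓝[<] t₀) (𝓝[<] 0) := by
      refine tendsto_nhdsWithin_iff.2 ⟨?_, ?_⟩
      · exact ((continuous_sub_right t₀).tendsto' t₀ 0 (sub_self t₀)).mono_left nhdsWithin_le_nhds
      · filter_upwards [self_mem_nhdsWithin] with t ht
        exact sub_neg.2 (mem_Iio.1 ht)
    simpa only [div_eq_mul_inv, Function.comp_def] using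
      (tendsto_inv_nhdsLT_zero.comp h1).const_mul_atBot (hpos n hn)
  have hunique : ∀ (τ : ℝ) (b : ℕ → ℝ) (Z : ℕ → ℝ → ℝ), t₀ ≤ τ →
      IsSelfSimilarSolutionWith (Ico 0 t₀) τ n₀ b Z → IsNegativeOn (Ico 0 t₀) Z →
        (∀ n, 1 ≤ n → b n = a n) ∧ ∀ n, ∀ t ∈ Ico 0 t₀, Z n t = a n / (t - τ) :=
    fun τ b Z hτ hZ hneg => hZ.coeff_eq ha hl (hnn _) hs h0 (uniqueDiffOn_Ico 0 t₀ 0 h0)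
      (by linarith) (mul_nonneg_of_nonpos_of_nonpos (hneg _ (by omega) 0 h0) (by linarith))
  refine ⟨a, fun n t => a n / (t - t₀), ⟨hsolves _ _ right_notMem_Ico, hnegative t₀⟩,
    fun b Z => hunique t₀ b Z le_rfl, ⟨⟨hself t₀, hnegative t₀, ?_⟩, fun Z hZ => ?_⟩,
    fun n hn => ⟨hpos n hn, fun t ht => div_neg_of_pos_of_neg (hpos n hn) (by linarith [ht.2]),
      hblow n hn⟩, ⟨_, hsolves _ _ self_notMem_Ioi, fun n _ t ht => div_nonneg (hnn n) ?_⟩,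
    fun b X hX hXpos n t ht => ?_⟩
  -- An extension past `t₀` would be continuous there, contradicting blow-up.
  · rintro ⟨T', hT', X', ⟨hX', -⟩, -, hext⟩
    have hcont : Tendsto (X' (n₀ + 1)) (𝓝[<] t₀) (𝓝 (X' (n₀ + 1) t₀)) := by
      have h1 := (hX'.contDiffOn (n₀ + 1)).continuousOn.continuousAt (Ico_mem_nhds ht₀ hT')
      exact h1.tendsto.mono_left nhdsWithin_le_nhds
    refine not_tendsto_nhds_of_tendsto_atBot (hblow (n₀ + 1) (by omega)) _ (hcont.congr' ?_)
    filter_upwards [Ico_mem_nhdsLT ht₀] with t ht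
    exact hext _ t ht
  -- If `t₀ < τ`, then `a n / (t - τ)` extends `Z` to `[0, τ)`, so maximality leaves only `τ = t₀`.
  · obtain ⟨τ, hτ, b, hb⟩ := hZ.exists_form ht₀
    have h := (hunique τ b Z hτ hb hZ.2.1).2
    rcases hτ.eq_or_lt with rfl | hlt
    · exact h
    · exact (hZ.2.2 ⟨τ, hlt, _, hself τ, hnegative τ, fun n t ht => (h n t ht).symm⟩).elim
  · have : -t₀ < t := ht
    linarith
  · have h0' : (0 : ℝ) ∈ Ioi (-t₀) := by simpa using ht₀
    have h := (hX.coeff_eq ha hl (hnn _) hs h0' (uniqueDiffOn_Ioi _ 0 h0') (by linarith)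
      (mul_nonneg (hXpos _ (by omega) 0 h0') (by linarith))).2 n (-t) (by simpa using ht.2)
    rw [h, ← div_neg]
    ring
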